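/- For $n\ge 3$ the $n$-dimensional alternating group network $AN_n$ is the simple graph whose vertices are the even permutations $p=(p_1p_2\cdots p_n)$ (in one-line notation) of $\{1,\dots,n\}$, where two vertices $p=(p_1\cdots p_n)$ and $q=(q_1\cdots q_n)$ are adjacent if and only if one of the following holds: (i) $p_1=q_2$, $p_2=q_3$, $p_3=q_1$, and $p_j=q_j$ for all $j\notin\{1,2,3\}$; (ii) $p_1=q_3$, $p_2=q_1$, $p_3=q_2$, and $p_j=q_j$ for all $j\notin\{1,2,3\}$; (iii) there is an $i\in\{4,\dots,n\}$ such that $p_1=q_2$, $p_2=q_1$, $p_3=q_i$, $p_i=q_3$, and $p_j=q_j$ for all $j\notin\{1,2,3,i\}$. For a finite graph $G$ and an integer $\ell\ge 2$, the $\ell$-component connectivity $\kappa_\ell(G)$ is the minimum number of vertices whose removal from $G$ results in a disconnected graph with at least $\ell$ components or in a graph with fewer than $\ell$ vertices. **Theorem.** For every $n\ge 4$, $\kappa_4(AN_n)=3n-6$. -/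

import Mathlib

/-- The `n`-dimensional alternating group network `AN_n` (`n ≥ 3`).
Its vertices are the even permutations of `n` symbols; the permutation `p` is read in one-line
notation as `(p₁ p₂ … pₙ)`, where `pₖ` is `p ⟨k - 1, _⟩` (positions and symbols are numbered from
`0` here). -/
def alternatingGroupNetwork (n : ℕ) (hn : 3 ≤ n) : SimpleGraph (alternatingGroup (Fin n)) where
  Adj p q :=
    let a : Fin n := ⟨0, by omega⟩
    let b : Fin n := ⟨1, by omega⟩
    let c : Fin n := ⟨2, by omega⟩
    (p.1 a = q.1 b ∧ p.1 b = q.1 c ∧ p.1 c = q.1 a ∧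
      ∀ j : Fin n, j ≠ a → j ≠ b → j ≠ c → p.1 j = q.1 j) ∨
    (p.1 a = q.1 c ∧ p.1 b = q.1 a ∧ p.1 c = q.1 b ∧
      ∀ j : Fin n, j ≠ a → j ≠ b → j ≠ c → p.1 j = q.1 j) ∨
    (∃ i : Fin n, 3 ≤ i.val ∧ p.1 a = q.1 b ∧ p.1 b = q.1 a ∧ p.1 c = q.1 i ∧ p.1 i = q.1 c ∧
      ∀ j : Fin n, j ≠ a → j ≠ b → j ≠ c → j ≠ i → p.1 j = q.1 j)
  symm := ⟨by
    rintro p q (⟨h1, h2, h3, h4⟩ | ⟨h1, h2, h3, h4⟩ | ⟨i, hi, h1, h2, h3, h4, h5⟩)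
    · exact Or.inr (Or.inl ⟨h3.symm, h1.symm, h2.symm, fun j ja jb jc => (h4 j ja jb jc).symm⟩)
    · exact Or.inl ⟨h2.symm, h3.symm, h1.symm, fun j ja jb jc => (h4 j ja jb jc).symm⟩
    · exact Or.inr (Or.inr ⟨i, hi, h2.symm, h1.symm, h4.symm, h3.symm,
        fun j ja jb jc ji => (h5 j ja jb jc ji).symm⟩)⟩
  loopless := ⟨by
    rintro p (⟨h, -⟩ | ⟨h, -⟩ | ⟨i, hi, h, -⟩) <;> simpa using p.1.injective h⟩

/-- Removing the vertex set `F` from `G` leaves a disconnected graph with at least `ℓ` components,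
or a graph with fewer than `ℓ` vertices. -/
def SimpleGraph.IsComponentCut {V : Type*} (G : SimpleGraph V) (ℓ : ℕ) (F : Finset V) : Prop :=
  (¬ (G.induce (F : Set V)ᶜ).Preconnected ∧
    ℓ ≤ Nat.card (G.induce (F : Set V)ᶜ).ConnectedComponent) ∨
  Nat.card ((F : Set V)ᶜ : Set V) < ℓ

/-- The `ℓ`-component connectivity `κ_ℓ(G)` (for `ℓ ≥ 2`) of a finite graph: the minimum size of a
vertex set `F` whose removal leaves a disconnected graph with at least `ℓ` components or a graph
with fewer than `ℓ` vertices. The minimum is over a nonempty set of numbers, because `F = V`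
always qualifies. -/
noncomputable def SimpleGraph.componentConnectivity {V : Type*} [Finite V] (G : SimpleGraph V)
    (ℓ : ℕ) : ℕ :=
  sInf {k : ℕ | ∃ F : Finset V, F.card = k ∧ G.IsComponentCut ℓ F}

/-! Upper bound. Let `s` rotate the first three positions and let `t` be the double transposition
that moves the fourth position. Then `(s * t) ^ 3 = 1`, so `1, s, s * t, …` runs around a hexagon.
Its alternate vertices `1`, `s * t`, `s * t * s * t` are pairwise nonadjacent, each has `n - 1`
neighbours, and each two share a hexagon vertex. Deleting all their neighbours costs at most `3 * (n
- 1) - 3` vertices, isolates the three and leaves a further vertex.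

Lower bound. Components are handled as colourings constant along surviving edges, so that a bound
restricts to subsets of vertices. The three clauses of `FewColours` are proved together by induction
on the block size. A block on `M + 1` positions splits into `M + 1` layers according to the symbol
in its last position; each layer is a block on `M` positions. Between layers, the matching `τ`
supplies at least `M - 1` edges for each pair. With at most `3 * M - 4` faults, no more than two
layers contain `M - 1` or more of them; all other layers are monochromatic by induction and share
one main colour (`exists_main_colour`). Other colours survive only inside the one or two bad layers,
where induction and the matching bound them (`fewColours_succ`). The induction starts at four
triangles, every two joined by an edge (`fewColours_four`). -/

section ColouringBounds

open Finset

variable {V ι : Type} [DecidableEq V] [DecidableEq ι]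

/-- Every colouring of `B \ F` that is constant along edges uses at most `1`, `2`, `3` colours when
`F` has at most `N - 2`, `2 * N - 4`, `3 * N - 7` elements in `B`, respectively. -/
def SimpleGraph.FewColours (G : SimpleGraph V) (B : Finset V) (N : ℕ) : Prop :=
  ∀ (F : Finset V) {γ : Type} [DecidableEq γ] (f : V → γ),
    (∀ u ∈ B \ F, ∀ v ∈ B \ F, G.Adj u v → f u = f v) →
      (#(B ∩ F) + 2 ≤ N → #((B \ F).image f) ≤ 1) ∧
      (#(B ∩ F) + 4 ≤ 2 * N → #((B \ F).image f) ≤ 2) ∧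
      (#(B ∩ F) + 7 ≤ 3 * N → #((B \ F).image f) ≤ 3)

/-- A vertex set `B` split into layers `last = i`, `i ∈ I`, such that every vertex `v` has a
partner `τ v` in the layer `third v`. -/
structure SimpleGraph.Layering (G : SimpleGraph V) (B : Finset V) (I : Finset ι)
    (last third : V → ι) (τ : V → V) : Prop where
  last_mem : ∀ v ∈ B, last v ∈ I
  third_mem : ∀ v ∈ B, third v ∈ I
  last_ne_third : ∀ v ∈ B, last v ≠ third v
  partner_mem : ∀ v ∈ B, τ v ∈ B
  partner_partner : ∀ v, τ (τ v) = v
  last_partner : ∀ v, last (τ v) = third v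
  third_partner : ∀ v, third (τ v) = last v
  adj_partner : ∀ v, G.Adj v (τ v)

/-! ### Counting faults against the matching between layers -/

namespace SimpleGraph.Layering

variable {G : SimpleGraph V} {B : Finset V} {I : Finset ι} {last third : V → ι} {τ : V → V}

-- Each matching edge from `S` is charged to a deleted endpoint. The charging is injective because
-- `S` contains at most one end of each edge.
omit [DecidableEq ι] in
theorem card_le_of_blocked (h : G.Layering B I last third τ) {F S W : Finset V}
    (hS : ∀ v ∈ S, τ v ∉ S) (hF : ∀ v ∈ S, v ∈ F ∨ τ v ∈ F)
    (hW : ∀ v ∈ S, v ∈ F → v ∈ W) (hW' : ∀ v ∈ S, τ v ∈ F → τ v ∈ W) : #S ≤ #W := by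
  refine card_le_card_of_injOn (fun v => if v ∈ F then v else τ v) ?_ ?_
  · intro v hv
    have hv' : v ∈ S := hv
    by_cases hvF : v ∈ F
    · simpa [hvF] using hW v hv' hvF
    · simpa [hvF] using hW' v hv' ((hF v hv').resolve_left hvF)
  · intro u hu v hv huv
    have hu' : u ∈ S := hu
    have hv' : v ∈ S := hv
    by_cases huF : u ∈ F <;> by_cases hvF : v ∈ F <;> simp only [huF, hvF, if_true, if_false] at huv
    · exact huv
    · exact absurd (huv ▸ hu') (hS v hv')
    · exact absurd (huv ▸ hv') (hS u hu')
    · rw [← h.partner_partner u, huv, h.partner_partner]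

omit [DecidableEq V] in
theorem card_mul_le_card (T : Finset (ι × ι)) {c : ℕ}
    (hc : ∀ p ∈ T, c ≤ #{v ∈ B | last v = p.1 ∧ third v = p.2}) :
    #T * c ≤ #{v ∈ B | (last v, third v) ∈ T} := by
  rw [card_eq_sum_card_fiberwise (f := fun v => (last v, third v)) (t := T)
    (fun v hv => by simpa using (mem_filter.1 (mem_coe.1 hv)).2), ← smul_eq_mul]
  refine card_nsmul_le_sum _ _ _ fun p hp => (hc p hp).trans (card_le_card ?_)
  rintro v hv
  obtain ⟨hvB, h1, h2⟩ : v ∈ B ∧ last v = p.1 ∧ third v = p.2 := by simpa using hv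
  simpa [hvB, h1, h2] using hp

/-- The number of elements of `F` in the layer `i`. -/
def faults (B F : Finset V) (last : V → ι) (i : ι) : ℕ := #{v ∈ B ∩ F | last v = i}

theorem sum_faults {J : Finset ι} (F : Finset V) :
    ∑ i ∈ J, faults B F last i = #{v ∈ B ∩ F | last v ∈ J} := by
  rw [card_eq_sum_card_fiberwise (f := last) (t := J)
    (fun v hv => by simpa using (mem_filter.1 (mem_coe.1 hv)).2)]
  refine sum_congr rfl fun i hi => congrArg card ?_
  ext v
  simp only [mem_filter]
  constructor
  · rintro ⟨hv, rfl⟩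
    exact ⟨⟨hv, hi⟩, rfl⟩
  · rintro ⟨⟨hv, -⟩, rfl⟩
    exact ⟨hv, rfl⟩

theorem sum_faults_univ (h : G.Layering B I last third τ) (F : Finset V) :
    ∑ i ∈ I, faults B F last i = #(B ∩ F) := by
  rw [sum_faults, filter_true_of_mem fun v hv => h.last_mem v (mem_inter.1 hv).1]

theorem faults_eq (F : Finset V) (i : ι) :
    faults B F last i = #({v ∈ B | last v = i} ∩ F) := by
  refine congrArg card ?_
  ext v
  simp only [mem_filter, mem_inter]
  tauto

/-- Otherwise every matching edge from layer `i` to the layers in `J` would need its own fault, and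
there are at least `#J * (M - 1)` such edges. -/
theorem exists_layer_not_mem (h : G.Layering B I last third τ) {M : ℕ}
    (hcount : ∀ i ∈ I, ∀ j ∈ I, i ≠ j → M - 1 ≤ #{v ∈ B | last v = i ∧ third v = j})
    {F : Finset V} {i : ι} (hi : i ∈ I) (J : Finset ι) (hJ : J ⊆ I) (hiJ : i ∉ J)
    (hF : #(B ∩ F) < #J * (M - 1)) :
    ∃ v ∈ B \ F, last v = i ∧ third v ∈ J ∧ τ v ∉ F := by
  by_contra! hcon
  have h1 : #(({i} : Finset ι) ×ˢ J) * (M - 1) ≤ _ :=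
    card_mul_le_card (B := B) (last := last) (third := third) (({i} : Finset ι) ×ˢ J)
      (c := M - 1) (by
        rintro ⟨x, j⟩ hp
        obtain ⟨hx, hj⟩ := mem_product.1 hp
        obtain rfl : x = i := mem_singleton.1 hx
        exact hcount _ hi j (hJ hj) (by rintro rfl; exact hiJ hj))
  have h2 : #{v ∈ B | (last v, third v) ∈ ({i} : Finset ι) ×ˢ J} ≤ #(B ∩ F) := by
    have key : ∀ v, v ∈ ({v ∈ B | (last v, third v) ∈ ({i} : Finset ι) ×ˢ J} : Finset V) ↔
        v ∈ B ∧ last v = i ∧ third v ∈ J := by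
      intro v
      simp only [mem_filter, mem_product, mem_singleton]
    refine h.card_le_of_blocked (F := F) ?_ ?_ ?_ ?_
    · intro v hv hv'
      rw [key] at hv hv'
      rw [h.last_partner] at hv'
      exact hiJ (hv'.2.1 ▸ hv.2.2)
    · intro v hv
      rw [key] at hv
      by_cases hvF : v ∈ F
      · exact Or.inl hvF
      · exact Or.inr (hcon v (mem_sdiff.2 ⟨hv.1, hvF⟩) hv.2.1 hv.2.2)
    · intro v hv hvF
      rw [key] at hv
      exact mem_inter.2 ⟨hv.1, hvF⟩
    · intro v hv hvF
      rw [key] at hv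
      exact mem_inter.2 ⟨h.partner_mem v hv.1, hvF⟩
  rw [card_product, card_singleton, one_mul] at h1
  omega

/-- All layers with at most `M - 2` faults have the same colour. -/
theorem exists_main_colour (h : G.Layering B I last third τ) {M : ℕ} (hM : 4 ≤ M)
    (hI : #I = M + 1)
    (hcount : ∀ i ∈ I, ∀ j ∈ I, i ≠ j → M - 1 ≤ #{v ∈ B | last v = i ∧ third v = j})
    (IH : ∀ i ∈ I, G.FewColours {v ∈ B | last v = i} M)
    {F : Finset V} {γ : Type} [DecidableEq γ] {f : V → γ}
    (hf : ∀ u ∈ B \ F, ∀ v ∈ B \ F, G.Adj u v → f u = f v)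
    (hF : #(B ∩ F) + 4 ≤ 3 * M) :
    #{i ∈ I | M - 1 ≤ faults B F last i} ≤ 2 ∧
    ∃ m, ∀ v ∈ B \ F, faults B F last (last v) < M - 1 → f v = m := by
  set φ := faults B F last with hφ
  set K := {i ∈ I | M - 1 ≤ φ i} with hK
  set g := {i ∈ I | ¬ (M - 1 ≤ φ i)} with hg
  have hKg : #K + #g = M + 1 := by rw [← hI]; exact card_filter_add_card_filter_not _
  have hsum : ∑ i ∈ K, φ i + ∑ i ∈ g, φ i = #(B ∩ F) := by
    rw [hK, hg, sum_filter_add_sum_filter_not, h.sum_faults_univ]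
  have hsumK : #K * (M - 1) ≤ ∑ i ∈ K, φ i := by
    rw [← smul_eq_mul]
    exact card_nsmul_le_sum _ _ _ fun i hi => (mem_filter.1 hi).2
  have hK2 : #K ≤ 2 := by
    by_contra! hlt
    have : 3 * (M - 1) ≤ #K * (M - 1) := Nat.mul_le_mul_right _ hlt
    omega
  refine ⟨hK2, ?_⟩
  have hconst : ∀ u ∈ B \ F, ∀ v ∈ B \ F, last u = last v → last u ∈ g → f u = f v := by
    intro u hu v hv huv hug
    have := (IH (last u) (mem_filter.1 hug).1 F f (fun x hx y hy => hf x ?_ y ?_)).1 ?_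
    · refine card_le_one.1 this _ (mem_image_of_mem _ ?_) _ (mem_image_of_mem _ ?_)
      · simp_all
      · simp_all
    · simp only [mem_sdiff, mem_filter] at hx ⊢
      exact ⟨hx.1.1, hx.2⟩
    · simp only [mem_sdiff, mem_filter] at hy ⊢
      exact ⟨hy.1.1, hy.2⟩
    · rw [← faults_eq, ← hφ]
      have := (mem_filter.1 hug).2
      omega
  have hgne : g.Nonempty := card_pos.1 (by omega)
  obtain ⟨i₀, hi₀⟩ := hgne
  have hi₀I := (mem_filter.1 hi₀).1
  obtain ⟨v₀, hv₀, hlv₀, -⟩ := h.exists_layer_not_mem hcount (F := F) hi₀I (I.erase i₀)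
    (erase_subset _ _) (notMem_erase _ _) (by
      rw [card_erase_of_mem hi₀I, hI]
      obtain ⟨k, rfl⟩ := Nat.exists_eq_add_of_le hM
      have e1 : 4 + k - 1 = k + 3 := by omega
      have e2 : 4 + k + 1 - 1 = k + 4 := by omega
      rw [e1, e2]
      nlinarith)
  refine ⟨f v₀, ?_⟩
  set A := {i ∈ g | ∀ v ∈ B \ F, last v = i → f v = f v₀} with hA
  set A' := {i ∈ g | ¬ ∀ v ∈ B \ F, last v = i → f v = f v₀} with hA'
  have hAA : #A + #A' = #g := card_filter_add_card_filter_not _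
  have hA0 : 0 < #A := card_pos.2 ⟨i₀, mem_filter.2 ⟨hi₀, fun v hv hl =>
    hconst v hv v₀ hv₀ (hl.trans hlv₀.symm) (hl ▸ hi₀)⟩⟩
  have hAg : ∀ i ∈ A, i ∈ g := fun i hi => (mem_filter.1 hi).1
  have hAg' : ∀ i ∈ A', i ∈ g := fun i hi => (mem_filter.1 hi).1
  have hgI : ∀ i ∈ g, i ∈ I := fun i hi => (mem_filter.1 hi).1
  have hdisj : ∀ i ∈ A, i ∉ A' := fun i hi hi' => (mem_filter.1 hi').2 (mem_filter.1 hi).2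
  -- A surviving matching edge from a layer in `A` to one in `A'` would carry the colour across, so
  -- each such edge costs a fault in a good layer. Together with the faults of the layers in `K`,
  -- this exceeds the budget.
  have hA'0 : #A' = 0 := by
    by_contra hpos
    have h1 := card_mul_le_card (B := B) (last := last) (third := third) (A ×ˢ A')
      (c := M - 1) (by
        rintro ⟨i, j⟩ hp
        obtain ⟨hi, hj⟩ := mem_product.1 hp
        exact hcount i (hgI _ (hAg _ hi)) j (hgI _ (hAg' _ hj))
          (by rintro rfl; exact hdisj _ hi hj))
    have h2 : #{v ∈ B | (last v, third v) ∈ A ×ˢ A'} ≤ #{v ∈ B ∩ F | last v ∈ g} := by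
      have key : ∀ v, v ∈ ({v ∈ B | (last v, third v) ∈ A ×ˢ A'} : Finset V) ↔
          v ∈ B ∧ last v ∈ A ∧ third v ∈ A' := by
        intro v; simp
      refine h.card_le_of_blocked (F := F) ?_ ?_ ?_ ?_
      · intro v hv hv'
        rw [key] at hv hv'
        rw [h.last_partner] at hv'
        exact hdisj _ hv'.2.1 hv.2.2
      · intro v hv
        rw [key] at hv
        by_contra! hvF
        have hvm := mem_sdiff.2 ⟨hv.1, hvF.1⟩
        have hτm := mem_sdiff.2 ⟨h.partner_mem v hv.1, hvF.2⟩
        have e1 : f v = f v₀ := (mem_filter.1 hv.2.1).2 v hvm rfl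
        have e2 := hf v hvm _ hτm (h.adj_partner v)
        refine (mem_filter.1 hv.2.2).2 fun u hu hl => ?_
        rw [← e1, e2]
        exact hconst u hu _ hτm (by rw [hl, h.last_partner]) (hl ▸ hAg' _ hv.2.2)
      · intro v hv hvF
        rw [key] at hv
        exact mem_filter.2 ⟨mem_inter.2 ⟨hv.1, hvF⟩, hAg _ hv.2.1⟩
      · intro v hv hvF
        rw [key] at hv
        exact mem_filter.2 ⟨mem_inter.2 ⟨h.partner_mem v hv.1, hvF⟩,
          (h.last_partner v).symm ▸ hAg' _ hv.2.2⟩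
    rw [← sum_faults, ← hφ] at h2
    rw [card_product] at h1
    obtain ⟨a, ha⟩ := Nat.exists_eq_add_of_lt hA0
    obtain ⟨b, hb⟩ := Nat.exists_eq_add_of_lt (Nat.pos_of_ne_zero hpos)
    obtain ⟨k, rfl⟩ := Nat.exists_eq_add_of_le hM
    have e1 : 4 + k - 1 = k + 3 := by omega
    rw [e1] at h1 hsumK
    have h3 : (#A * #A' + #K) * (k + 3) ≤ 3 * k + 8 := by
      rw [add_mul]; omega
    have h4 : k + 4 ≤ #A * #A' + #K := by
      have : #A + #A' ≤ #A * #A' + 1 := by rw [ha, hb]; nlinarith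
      omega
    nlinarith
  intro v hv hlt
  have hvg : last v ∈ g := mem_filter.2 ⟨h.last_mem v (mem_sdiff.1 hv).1, by omega⟩
  by_contra hne
  have : last v ∈ A' := mem_filter.2 ⟨hvg, fun hall => hne (hall v hv rfl)⟩
  rw [card_eq_zero] at hA'0
  simp [hA'0] at this

end SimpleGraph.Layering

end ColouringBounds

/-! ### Colour bounds: induction step and base case -/

section ColouringBounds

open Finset

variable {V ι : Type} [DecidableEq V] [DecidableEq ι]

namespace SimpleGraph.Layering

variable {G : SimpleGraph V} {B : Finset V} {I : Finset ι} {last third : V → ι} {τ : V → V}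

/-- The cases are zero, one or two bad layers, those with at least `M - 1` faults. The delicate one
is two bad layers holding all the faults, one of them exactly `M - 1`: there `hdeg` and `hthird`
prevent both layers from contributing separate new colours. -/
theorem fewColours_succ [DecidableRel G.Adj] (h : G.Layering B I last third τ) {M : ℕ} (hM : 4 ≤ M)
    (hI : #I = M + 1)
    (hcount : ∀ i ∈ I, ∀ j ∈ I, i ≠ j → M - 1 ≤ #{v ∈ B | last v = i ∧ third v = j})
    (hthird : ∀ u v, G.Adj u v → third u ≠ third v)
    (hdeg : ∀ v ∈ B, M - 1 ≤ #{u ∈ B | G.Adj v u ∧ last u = last v})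
    (IH : ∀ i ∈ I, G.FewColours {v ∈ B | last v = i} M) : G.FewColours B (M + 1) := by
  intro F γ _ f hf
  by_cases hF : #(B ∩ F) + 4 ≤ 3 * M
  swap
  · exact ⟨fun _ => by omega, fun _ => by omega, fun _ => by omega⟩
  obtain ⟨hK2, m, hm⟩ := h.exists_main_colour hM hI hcount IH hf hF
  have hφI : ∀ J ⊆ I, ∑ i ∈ J, faults B F last i ≤ #(B ∩ F) := fun J hJ =>
    (sum_le_sum_of_subset hJ).trans (h.sum_faults_univ F).le
  have IH' : ∀ i ∈ I, _ := fun i hi => IH i hi F f (fun u hu v hv => by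
    simp only [mem_sdiff, mem_filter] at hu hv
    exact hf u (mem_sdiff.2 ⟨hu.1.1, hu.2⟩) v (mem_sdiff.2 ⟨hv.1.1, hv.2⟩))
  simp only [← faults_eq] at IH'
  have hφ : ∀ i, faults B F last i = #{v ∈ B ∩ F | last v = i} := fun i => rfl
  generalize faults B F last = φ at *
  set K := {i ∈ I | M - 1 ≤ φ i} with hK
  set X := (B \ F).image f with hX
  set L : ι → Finset γ := fun i => (({v ∈ B | last v = i} : Finset V) \ F).image f with hL
  have hKI : K ⊆ I := filter_subset _ _
  have mem_L : ∀ v ∈ B \ F, f v ∈ L (last v) := fun v hv => by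
    refine mem_image_of_mem _ ?_
    obtain ⟨hvB, hvF⟩ := mem_sdiff.1 hv
    exact mem_sdiff.2 ⟨mem_filter.2 ⟨hvB, rfl⟩, hvF⟩
  have main_of_last : ∀ v ∈ B \ F, last v ∉ K → f v = m := fun v hv hvK =>
    hm v hv (by
      by_contra hlt
      exact hvK (mem_filter.2 ⟨h.last_mem v (mem_sdiff.1 hv).1, by omega⟩))
  have main_of_third : ∀ v ∈ B \ F, τ v ∉ F → third v ∉ K → f v = m := fun v hv hτ hvK => by
    have hτm := mem_sdiff.2 ⟨h.partner_mem v (mem_sdiff.1 hv).1, hτ⟩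
    rw [hf v hv _ hτm (h.adj_partner v)]
    exact main_of_last _ hτm (by rwa [h.last_partner])
  -- A bad layer has at least `(M - 1) * (M - 1)` matching edges to good layers, more than there are
  -- faults, so the main colour enters it.
  have main_mem : ∀ i ∈ K, m ∈ L i := fun i hi => by
    have hc : M - 1 ≤ #(I \ K) := by rw [card_sdiff_of_subset hKI]; omega
    obtain ⟨v, hv, rfl, hthv, hτ⟩ := h.exists_layer_not_mem hcount (F := F) (hKI hi) (I \ K)
      sdiff_subset (by simp [hi]) (lt_of_lt_of_le (by
        obtain ⟨k, rfl⟩ := Nat.exists_eq_add_of_le hM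
        have e1 : 4 + k - 1 = k + 3 := by omega
        rw [e1]
        nlinarith : #(B ∩ F) < (M - 1) * (M - 1)) (Nat.mul_le_mul_right _ hc))
    rw [← main_of_third v hv hτ (mem_sdiff.1 hthv).2]
    exact mem_L v hv
  have sub_L : ∀ i ∈ K, (∀ v ∈ B \ F, f v ≠ m → f v ∈ L i) → #X ≤ #(L i) := fun i hi hv => by
    refine card_le_card fun x hx => ?_
    obtain ⟨v, hvm, rfl⟩ := mem_image.1 hx
    by_cases hvf : f v = m
    · exact hvf ▸ main_mem i hi
    · exact hv v hvm hvf
  interval_cases hKc : #K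
  · rw [card_eq_zero] at hKc
    have : #X ≤ 1 := by
      refine card_le_one.2 fun a ha b hb => ?_
      obtain ⟨u, hu, rfl⟩ := mem_image.1 ha
      obtain ⟨v, hv, rfl⟩ := mem_image.1 hb
      rw [main_of_last u hu (by simp [hKc]), main_of_last v hv (by simp [hKc])]
    omega
  · obtain ⟨i, hKi⟩ := card_eq_one.1 hKc
    have hiK : i ∈ K := by simp [hKi]
    have h1 : #X ≤ #(L i) := sub_L i hiK fun v hv hvf => by
      have : last v ∈ K := by
        by_contra hvK
        exact hvf (main_of_last v hv hvK)
      rw [hKi, mem_singleton] at this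
      exact this ▸ mem_L v hv
    -- A vertex off the main colour lies in layer `i`, and its partner is a fault outside that
    -- layer. So each additional colour uses up a fault that layer `i` does not have.
    have h2 : #X + φ i ≤ #(B ∩ F) + 1 := by
      have e1 : φ i + #{v ∈ B ∩ F | ¬ last v = i} = #(B ∩ F) := by
        rw [hφ]; exact card_filter_add_card_filter_not _
      have e2 : #{v ∈ B \ F | f v ≠ m} ≤ #{v ∈ B ∩ F | ¬ last v = i} := by
        refine card_le_card_of_injOn τ (fun v hv => ?_) (fun u _ v _ huv => ?_)
        · obtain ⟨hvm, hvf⟩ := mem_filter.1 (mem_coe.1 hv)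
          have hvB := (mem_sdiff.1 hvm).1
          have hlK : last v ∈ K := by
            by_contra hvK
            exact hvf (main_of_last v hvm hvK)
          rw [hKi, mem_singleton] at hlK
          have hthi : third v ≠ i := hlK ▸ (h.last_ne_third v hvB).symm
          refine mem_coe.2 (mem_filter.2 ⟨mem_inter.2 ⟨h.partner_mem v hvB, ?_⟩, ?_⟩)
          · by_contra hτ
            exact hvf (main_of_third v hvm hτ (by simp [hKi, hthi]))
          · rwa [h.last_partner]
        · rw [← h.partner_partner u, huv, h.partner_partner]
      have e3 : #X ≤ #({v ∈ B \ F | f v ≠ m}.image f) + 1 := by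
        refine (card_le_card fun x hx => ?_).trans (card_insert_le m _)
        obtain ⟨v, hvm, rfl⟩ := mem_image.1 hx
        by_cases hvf : f v = m
        · simp [hvf]
        · exact mem_insert_of_mem (mem_image_of_mem _ (mem_filter.2 ⟨hvm, hvf⟩))
      have e4 := card_image_le (s := {v ∈ B \ F | f v ≠ m}) (f := f)
      omega
    obtain ⟨g1, g2, g3⟩ := IH' i (hKI hiK)
    change (_ → #(L i) ≤ 1) at g1
    change (_ → #(L i) ≤ 2) at g2
    change (_ → #(L i) ≤ 3) at g3
    omega
  · obtain ⟨i, j, hij, hKij⟩ := card_eq_two.1 hKc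
    -- With all faults in the two bad layers, a vertex off the main colour has its partner in the
    -- other bad layer. One of the two layers then already shows every colour.
    have key : ∀ i ∈ K, ∀ j ∈ K, K = {i, j} → φ j = M - 1 → φ i + φ j = #(B ∩ F) →
        #X ≤ #(L i) ∨ #X ≤ #(L j) := by
      intro i hi j hj hKij hφj hφs
      by_cases hij' : i = j
      · subst hij'
        simp [hKij] at hKc
      have hFK : ∀ v ∈ B, last v ∉ K → v ∉ F := fun v hv hvK hvF => by
        have hs : #{v ∈ B ∩ F | last v ∈ K} = #(B ∩ F) := by
          rw [← hφs, hφ, hφ, ← card_union_of_disjoint, ← filter_or]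
          · simp [hKij]
          · exact disjoint_filter.2 fun x _ hx hx' => hij' (hx.symm.trans hx')
        exact hvK (card_filter_eq_iff.1 hs v (mem_inter.2 ⟨hv, hvF⟩))
      have hlK : ∀ v ∈ B \ F, f v ≠ m → last v ∈ K := fun v hv hvf => by
        by_contra hvK
        exact hvf (main_of_last v hv hvK)
      have htK : ∀ v ∈ B \ F, f v ≠ m → third v ∈ K := fun v hv hvf => by
        by_contra hvK
        exact hvf (main_of_third v hv
          (hFK _ (h.partner_mem v (mem_sdiff.1 hv).1) (by rwa [h.last_partner])) hvK)
      by_cases hw : ∃ w ∈ B \ F, f w ≠ m ∧ last w = j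
      · obtain ⟨w, hwm, hwf, hwj⟩ := hw
        have hwB := (mem_sdiff.1 hwm).1
        have hwi : third w = i := by
          have h1 := htK w hwm hwf
          have h2 := h.last_ne_third w hwB
          rw [hKij] at h1
          simp only [mem_insert, mem_singleton] at h1
          rcases h1 with h1 | h1
          · exact h1
          · exact absurd (hwj.trans h1.symm) h2
        -- A surviving neighbour of `w` in layer `j` would also be off the main colour, hence have
        -- third symbol `i` like `w`, which adjacency forbids. So the neighbours of `w` in the layer
        -- are all faults, and since there are at least `M - 1 = φ j` of them, they are all the
        -- faults of layer `j`.
        have hN : {x ∈ B | G.Adj w x ∧ last x = last w} = {v ∈ B ∩ F | last v = j} := by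
          refine eq_of_subset_of_card_le (fun x hx => ?_)
            (by rw [← hφ, hφj]; exact hdeg w hwB)
          obtain ⟨hxB, hwx, hlx⟩ := mem_filter.1 hx
          refine mem_filter.2 ⟨mem_inter.2 ⟨hxB, ?_⟩, hlx.trans hwj⟩
          by_contra hxF
          have hxm := mem_sdiff.2 ⟨hxB, hxF⟩
          have h1 := htK x hxm (by rwa [← hf w hwm x hxm hwx])
          rw [hKij] at h1
          simp only [mem_insert, mem_singleton] at h1
          rcases h1 with h1 | h1
          · exact hthird w x hwx (hwi.trans h1.symm)
          · exact h.last_ne_third x hxB (by rw [hlx, hwj, h1])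
        refine Or.inr (sub_L j hj fun v hvm hvf => ?_)
        have h1 := hlK v hvm hvf
        have h2 := htK v hvm hvf
        have h3 := h.last_ne_third v (mem_sdiff.1 hvm).1
        rw [hKij] at h1 h2
        simp only [mem_insert, mem_singleton] at h1 h2
        by_cases hvj : last v = j
        · exact hvj ▸ mem_L v hvm
        have hvi : last v = i := h1.resolve_right hvj
        have htj : third v = j := h2.resolve_left fun h4 => h3 (hvi.trans h4.symm)
        have hτB := h.partner_mem v (mem_sdiff.1 hvm).1
        -- The partner has the same third symbol as `w`, so it is not a neighbour of `w` and hence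
        -- not a fault.
        have hτF : τ v ∉ F := fun hτF => by
          have : τ v ∈ ({v ∈ B ∩ F | last v = j} : Finset V) :=
            mem_filter.2 ⟨mem_inter.2 ⟨hτB, hτF⟩, (h.last_partner v).trans htj⟩
          rw [← hN] at this
          refine hthird _ _ (mem_filter.1 this).2.1 ?_
          rw [h.third_partner, hvi, hwi]
        have hτm := mem_sdiff.2 ⟨hτB, hτF⟩
        rw [hf v hvm _ hτm (h.adj_partner v), ← htj, ← h.last_partner]
        exact mem_L _ hτm
      · push Not at hw
        refine Or.inl (sub_L i hi fun v hvm hvf => ?_)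
        have h1 := hlK v hvm hvf
        rw [hKij] at h1
        simp only [mem_insert, mem_singleton] at h1
        exact (h1.resolve_right (hw v hvm hvf)) ▸ mem_L v hvm
    have hiK : i ∈ K := by simp [hKij]
    have hjK : j ∈ K := by simp [hKij]
    have hXij : #X + 1 ≤ #(L i) + #(L j) := by
      have h1 : X ⊆ L i ∪ L j := fun x hx => by
        obtain ⟨v, hvm, rfl⟩ := mem_image.1 hx
        by_cases hvf : f v = m
        · exact mem_union_left _ (hvf ▸ main_mem i hiK)
        · have hlK : last v ∈ K := by
            by_contra hvK
            exact hvf (main_of_last v hvm hvK)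
          rw [hKij] at hlK
          simp only [mem_insert, mem_singleton] at hlK
          rcases hlK with hl | hl
          · exact mem_union_left _ (hl ▸ mem_L v hvm)
          · exact mem_union_right _ (hl ▸ mem_L v hvm)
      have h2 : 1 ≤ #(L i ∩ L j) :=
        card_pos.2 ⟨m, mem_inter.2 ⟨main_mem i hiK, main_mem j hjK⟩⟩
      have h3 := card_union_add_card_inter (L i) (L j)
      have h4 := card_le_card h1
      omega
    have hsum : φ i + φ j ≤ #(B ∩ F) := by
      have := hφI K hKI
      rwa [hKij, sum_pair hij] at this
    have hφi := (mem_filter.1 hiK).2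
    have hφj := (mem_filter.1 hjK).2
    obtain ⟨g1, g2, g3⟩ := IH' i (hKI hiK)
    change (_ → #(L i) ≤ 1) at g1
    change (_ → #(L i) ≤ 2) at g2
    change (_ → #(L i) ≤ 3) at g3
    obtain ⟨g4, g5, g6⟩ := IH' j (hKI hjK)
    change (_ → #(L j) ≤ 1) at g4
    change (_ → #(L j) ≤ 2) at g5
    change (_ → #(L j) ≤ 3) at g6
    have k1 := key i hiK j hjK hKij
    have k2 := key j hjK i hiK (by rw [hKij, pair_comm])
    -- `hXij` suffices except at the extremes: totals `2 * M - 2`, split equally, and `3 * M - 4`,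
    -- split as `2 * M - 3` and `M - 1`. These use `k1` or `k2`.
    omega

/-- Splitting the vertices of a complete graph on four vertices into two, three or four classes cuts
at least three, five or six edges, and each cut edge costs a fault. -/
theorem card_image_fin_four_le {γ : Type} [DecidableEq γ] (c : Fin 4 → γ)
    (x : Fin 4 → Fin 4 → ℕ) (hx : ∀ i j, i ≠ j → c i ≠ c j → 1 ≤ x i j + x j i) {A : ℕ}
    (hA : ∑ i, ∑ j, (if i = j then 0 else x i j) ≤ A) :
    (A + 2 ≤ 4 → #(univ.image c) ≤ 1) ∧ (A + 4 ≤ 2 * 4 → #(univ.image c) ≤ 2) ∧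
      (A + 7 ≤ 3 * 4 → #(univ.image c) ≤ 3) := by
  have himg : univ.image c = {c 0, c 1, c 2, c 3} := by
    ext y
    simp [Fin.exists_fin_succ, eq_comm]
  rw [himg]
  simp [Fin.sum_univ_four] at hA
  have h01 := hx 0 1 (by decide)
  have h02 := hx 0 2 (by decide)
  have h03 := hx 0 3 (by decide)
  have h12 := hx 1 2 (by decide)
  have h13 := hx 1 3 (by decide)
  have h23 := hx 2 3 (by decide)
  generalize c 0 = p at *
  generalize c 1 = q at *
  generalize c 2 = r at *
  generalize c 3 = s at *
  have d1 : #({p, q, r, s} : Finset γ) ≤ 4 := card_le_four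
  clear hx himg
  by_cases e1 : p = q <;> by_cases e2 : p = r <;> by_cases e3 : p = s <;> by_cases e4 : q = r <;>
    by_cases e5 : q = s <;> by_cases e6 : r = s <;>
    (try replace h01 := h01 e1) <;> (try replace h02 := h02 e2) <;> (try replace h03 := h03 e3) <;>
    (try replace h12 := h12 e4) <;> (try replace h13 := h13 e5) <;> (try replace h23 := h23 e6) <;>
    (try simp_all only [ne_eq, not_true_eq_false, insert_eq_of_mem, mem_insert, mem_singleton,
      true_or, or_true, card_singleton, IsEmpty.forall_iff]) <;>
    refine ⟨fun _ => ?_, fun _ => ?_, fun _ => ?_⟩ <;>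
    first
    | trivial
    | exact card_le_two
    | exact card_le_three
    | exact card_le_two.trans (Nat.le_succ 2)
    | omega

theorem fewColours_four (h : G.Layering B I last third τ) (hI : #I = 4)
    (hex : ∀ i ∈ I, ∀ j ∈ I, i ≠ j → ∃ v ∈ B, last v = i ∧ third v = j)
    (hclique : ∀ u ∈ B, ∀ v ∈ B, last u = last v → u = v ∨ G.Adj u v) : G.FewColours B 4 := by
  classical
  intro F γ _ f hf
  obtain hemp | ⟨v₀, hv₀⟩ := (B \ F).eq_empty_or_nonempty
  · simp [hemp]
  let e : Fin 4 ≃ I := (I.equivFinOfCardEq hI).symm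
  have hex' : ∀ a b : Fin 4, ∃ v, a ≠ b → v ∈ B ∧ last v = e a ∧ third v = e b := by
    intro a b
    by_cases hab : a = b
    · exact ⟨v₀, fun hne => absurd hab hne⟩
    · obtain ⟨v, hv, h1, h2⟩ := hex (e a) (e a).2 (e b) (e b).2
        fun hne => hab (e.injective (Subtype.ext hne))
      exact ⟨v, fun _ => ⟨hv, h1, h2⟩⟩
  choose w' hw' using hex'
  obtain ⟨w, hw, hwτ⟩ : ∃ w : Fin 4 → Fin 4 → V,
      (∀ a b, a ≠ b → w a b ∈ B ∧ last (w a b) = e a ∧ third (w a b) = e b) ∧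
      ∀ a b, a ≠ b → τ (w a b) = w b a := by
    -- The representative is chosen for `a < b` only and transported by `τ`, which makes the two
    -- ends of each joining edge partners.
    refine ⟨fun a b => if a < b then w' a b else τ (w' b a), fun a b hab => ?_, fun a b hab => ?_⟩
    · by_cases hlt : a < b
      · simpa [hlt] using hw' a b hab
      · obtain ⟨h1, h2, h3⟩ := hw' b a hab.symm
        simp [hlt, h.partner_mem _ h1, h.last_partner, h.third_partner, h2, h3]
    · rcases lt_or_gt_of_ne hab with hlt | hlt
      · simp [hlt, hlt.not_gt]
      · simp [hlt, hlt.not_gt, h.partner_partner]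
  have hcol : ∀ i, ∃ c, ∀ v ∈ B \ F, last v = i → f v = c := by
    intro i
    by_cases hi : ∃ u ∈ B \ F, last u = i
    · obtain ⟨u, hu, hui⟩ := hi
      refine ⟨f u, fun v hv hvi => ?_⟩
      rcases hclique v (mem_sdiff.1 hv).1 u (mem_sdiff.1 hu).1 (hvi.trans hui.symm) with huv | huv
      · rw [huv]
      · exact hf v hv u hu huv
    · push Not at hi
      -- A wholly deleted layer gets an arbitrary colour that is already in use.
      exact ⟨f v₀, fun v hv hvi => absurd hvi (hi v hv)⟩
  choose c hc using hcol
  have hsub : (B \ F).image f ⊆ univ.image fun a : Fin 4 => c (e a) := fun x hx => by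
    obtain ⟨v, hv, rfl⟩ := mem_image.1 hx
    refine mem_image.2 ⟨e.symm ⟨last v, h.last_mem v (mem_sdiff.1 hv).1⟩, mem_univ _, ?_⟩
    simpa using (hc _ v hv rfl).symm
  have hle := card_le_card hsub
  obtain ⟨h1, h2, h3⟩ := card_image_fin_four_le (fun a : Fin 4 => c (e a))
    (fun a b => if w a b ∈ F then 1 else 0) (A := #(B ∩ F)) (by
      intro a b hab hne
      by_contra hlt
      have ha : w a b ∉ F := fun hF => hlt (by simp [hF])
      obtain ⟨hB, hl, ht⟩ := hw a b hab
      have hb : w b a ∉ F := fun hF => hlt (by simp [hF])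
      rw [← hwτ a b hab] at hb
      refine hne ?_
      obtain ⟨hB, hl, ht⟩ := hw a b hab
      have hm := mem_sdiff.2 ⟨hB, ha⟩
      have hm' := mem_sdiff.2 ⟨h.partner_mem _ hB, hb⟩
      change c (e a) = c (e b)
      rw [← hc _ _ hm hl, ← hc _ _ hm' ((h.last_partner _).trans ht)]
      exact hf _ hm _ hm' (h.adj_partner _)) (by
      rw [← Fintype.sum_prod_type' (fun a b : Fin 4 => if a = b then 0 else if w a b ∈ F then 1 else 0)]
      have hite : ∀ p : Fin 4 × Fin 4, (if p.1 = p.2 then 0 else if w p.1 p.2 ∈ F then 1 else 0) =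
          if p.1 ≠ p.2 ∧ w p.1 p.2 ∈ F then 1 else 0 := by
        intro p
        by_cases hp : p.1 = p.2 <;> simp [hp]
      simp only [hite]
      rw [← card_filter]
      refine card_le_card_of_injOn (fun p => w p.1 p.2) (fun p hp => ?_) fun p hp q hq hpq => ?_
      · obtain ⟨-, hne, hF⟩ := mem_filter.1 (mem_coe.1 hp)
        exact mem_coe.2 (mem_inter.2 ⟨(hw _ _ hne).1, hF⟩)
      · obtain ⟨-, hp1, hp2⟩ := hw _ _ (mem_filter.1 (mem_coe.1 hp)).2.1
        obtain ⟨-, hq1, hq2⟩ := hw _ _ (mem_filter.1 (mem_coe.1 hq)).2.1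
        have hpq' : w p.1 p.2 = w q.1 q.2 := hpq
        rw [hpq'] at hp1 hp2
        exact Prod.ext (e.injective (Subtype.ext (hp1.symm.trans hq1)))
          (e.injective (Subtype.ext (hp2.symm.trans hq2))))
  exact ⟨fun hA => hle.trans (h1 hA), fun hA => hle.trans (h2 hA), fun hA => hle.trans (h3 hA)⟩

end SimpleGraph.Layering

end ColouringBounds

/-! ### Generators and adjacency of the network -/

section AlternatingGroupNetwork

open Finset Equiv

namespace AlternatingGroupNetwork

variable {n : ℕ}

/-- The first position of the one-line notation. -/
def posOne (hn : 3 ≤ n) : Fin n := ⟨0, by omega⟩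

/-- The second position of the one-line notation. -/
def posTwo (hn : 3 ≤ n) : Fin n := ⟨1, by omega⟩

/-- The third position of the one-line notation. -/
def posThree (hn : 3 ≤ n) : Fin n := ⟨2, by omega⟩

variable (hn : 3 ≤ n)

local notation "a₁" => posOne hn
local notation "a₂" => posTwo hn
local notation "a₃" => posThree hn

theorem one_ne_two : a₁ ≠ a₂ := by simp [posOne, posTwo]
theorem one_ne_three : a₁ ≠ a₃ := by simp [posOne, posThree]
theorem two_ne_three : a₂ ≠ a₃ := by simp [posTwo, posThree]

variable {hn} in
theorem ne_of_three_le {k : Fin n} (hk : 3 ≤ k.val) : k ≠ a₁ ∧ k ≠ a₂ ∧ k ≠ a₃ := by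
  refine ⟨?_, ?_, ?_⟩ <;> rintro rfl <;> simp [posOne, posTwo, posThree] at hk

variable {hn} in
theorem three_le_of_ne {k : Fin n} (h1 : k ≠ a₁) (h2 : k ≠ a₂) (h3 : k ≠ a₃) : 3 ≤ k.val := by
  simp only [posOne, posTwo, posThree, ne_eq, Fin.ext_iff] at h1 h2 h3
  omega

theorem adj_iff (p q : alternatingGroup (Fin n)) : (alternatingGroupNetwork n hn).Adj p q ↔
    (p.1 a₁ = q.1 a₂ ∧ p.1 a₂ = q.1 a₃ ∧ p.1 a₃ = q.1 a₁ ∧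
      ∀ j : Fin n, j ≠ a₁ → j ≠ a₂ → j ≠ a₃ → p.1 j = q.1 j) ∨
    (p.1 a₁ = q.1 a₃ ∧ p.1 a₂ = q.1 a₁ ∧ p.1 a₃ = q.1 a₂ ∧
      ∀ j : Fin n, j ≠ a₁ → j ≠ a₂ → j ≠ a₃ → p.1 j = q.1 j) ∨
    (∃ i : Fin n, 3 ≤ i.val ∧ p.1 a₁ = q.1 a₂ ∧ p.1 a₂ = q.1 a₁ ∧ p.1 a₃ = q.1 i ∧
      p.1 i = q.1 a₃ ∧
      ∀ j : Fin n, j ≠ a₁ → j ≠ a₂ → j ≠ a₃ → j ≠ i → p.1 j = q.1 j) := Iff.rfl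

-- Permutations with a common second symbol therefore form an independent set; this keeps the three
-- isolated vertices out of the cut.
variable {hn} in
theorem two_ne_of_adj {p q : alternatingGroup (Fin n)}
    (h : (alternatingGroupNetwork n hn).Adj p q) : p.1 a₂ ≠ q.1 a₂ := by
  intro he
  rcases (adj_iff hn p q).1 h with ⟨-, h1, -⟩ | ⟨-, h1, -⟩ | ⟨i, -, -, h1, -⟩
  · exact two_ne_three hn (q.1.injective (he.symm.trans h1))
  · exact one_ne_two hn (q.1.injective (h1.symm.trans he))
  · exact one_ne_two hn (q.1.injective (h1.symm.trans he))

variable {hn} in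
theorem three_ne_of_adj {p q : alternatingGroup (Fin n)}
    (h : (alternatingGroupNetwork n hn).Adj p q) : p.1 a₃ ≠ q.1 a₃ := by
  intro he
  rcases (adj_iff hn p q).1 h with ⟨-, -, h1, -⟩ | ⟨-, -, h1, -⟩ | ⟨i, hi, -, -, h1, -⟩
  · exact one_ne_three hn (q.1.injective (h1.symm.trans he))
  · exact two_ne_three hn (q.1.injective (h1.symm.trans he))
  · exact (ne_of_three_le (hn := hn) hi).2.2 (q.1.injective (h1.symm.trans he))

/-- The rotation of the first three positions. -/
def rot : alternatingGroup (Fin n) :=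
  ⟨swap a₁ a₂ * swap a₂ a₃, by
    rw [Perm.mem_alternatingGroup, map_mul, Perm.sign_swap (one_ne_two hn),
      Perm.sign_swap (two_ne_three hn)]
    rfl⟩

/-- The double transposition of the first two positions and of the positions `3` and `k`. -/
def flip (k : Fin n) (hk : 3 ≤ k.val) : alternatingGroup (Fin n) :=
  ⟨swap a₁ a₂ * swap a₃ k, by
    rw [Perm.mem_alternatingGroup, map_mul, Perm.sign_swap (one_ne_two hn),
      Perm.sign_swap (ne_of_three_le hk).2.2.symm]
    rfl⟩

theorem rot_one : (rot hn).1 a₁ = a₂ := by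
  simp [rot, swap_apply_of_ne_of_ne (one_ne_two hn) (one_ne_three hn)]

theorem rot_two : (rot hn).1 a₂ = a₃ := by
  simp [rot, swap_apply_of_ne_of_ne (one_ne_three hn).symm (two_ne_three hn).symm]

theorem rot_three : (rot hn).1 a₃ = a₁ := by simp [rot]

theorem rot_of_ne {j : Fin n} (h1 : j ≠ a₁) (h2 : j ≠ a₂) (h3 : j ≠ a₃) : (rot hn).1 j = j := by
  simp [rot, swap_apply_of_ne_of_ne h1 h2, swap_apply_of_ne_of_ne h2 h3]

section

variable {k : Fin n} (hk : 3 ≤ k.val)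

theorem flip_one : (flip hn k hk).1 a₁ = a₂ := by
  simp [flip, swap_apply_of_ne_of_ne (one_ne_three hn) (ne_of_three_le hk).1.symm]

theorem flip_two : (flip hn k hk).1 a₂ = a₁ := by
  simp [flip, swap_apply_of_ne_of_ne (two_ne_three hn) (ne_of_three_le hk).2.1.symm]

theorem flip_three : (flip hn k hk).1 a₃ = k := by
  simp [flip, swap_apply_of_ne_of_ne (ne_of_three_le (hn := hn) hk).1 (ne_of_three_le hk).2.1]

theorem flip_self : (flip hn k hk).1 k = a₃ := by
  simp [flip, swap_apply_of_ne_of_ne (one_ne_three hn).symm (two_ne_three hn).symm]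

theorem flip_of_ne {j : Fin n} (h1 : j ≠ a₁) (h2 : j ≠ a₂) (h3 : j ≠ a₃) (h4 : j ≠ k) :
    (flip hn k hk).1 j = j := by
  simp [flip, swap_apply_of_ne_of_ne h1 h2, swap_apply_of_ne_of_ne h3 h4]

theorem flip_mul_flip : flip hn k hk * flip hn k hk = 1 := by
  refine Subtype.ext (Equiv.ext fun j => ?_)
  change (flip hn k hk).1 ((flip hn k hk).1 j) = j
  by_cases h1 : j = a₁
  · rw [h1, flip_one, flip_two]
  by_cases h2 : j = a₂
  · rw [h2, flip_two, flip_one]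
  by_cases h3 : j = a₃
  · rw [h3, flip_three, flip_self]
  by_cases h4 : j = k
  · rw [h4, flip_self, flip_three]
  rw [flip_of_ne hn hk h1 h2 h3 h4, flip_of_ne hn hk h1 h2 h3 h4]

/-- Since the flip is an involution, this says that the product of rotation and flip has cube `1`,
which closes the hexagon behind the upper bound. -/
theorem rot_mul_flip_braid :
    rot hn * flip hn k hk * rot hn * flip hn k hk * rot hn = flip hn k hk := by
  obtain ⟨k1, k2, k3⟩ := ne_of_three_le (hn := hn) hk
  refine Subtype.ext (Equiv.ext fun j => ?_)
  simp only [Subgroup.coe_mul, Perm.mul_apply]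
  by_cases h1 : j = a₁
  · rw [h1, rot_one, flip_two, rot_one, flip_two, rot_one, flip_one]
  by_cases h2 : j = a₂
  · rw [h2, rot_two, flip_three, rot_of_ne hn k1 k2 k3, flip_self, rot_three, flip_two]
  by_cases h3 : j = a₃
  · rw [h3, rot_three, flip_one, rot_two, flip_three, rot_of_ne hn k1 k2 k3]
  by_cases h4 : j = k
  · rw [h4, rot_of_ne hn k1 k2 k3, flip_self, rot_three, flip_one, rot_two]
  rw [rot_of_ne hn h1 h2 h3, flip_of_ne hn hk h1 h2 h3 h4, rot_of_ne hn h1 h2 h3,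
    flip_of_ne hn hk h1 h2 h3 h4, rot_of_ne hn h1 h2 h3]

theorem adj_mul_flip (v : alternatingGroup (Fin n)) :
    (alternatingGroupNetwork n hn).Adj v (v * flip hn k hk) := by
  rw [adj_iff]
  refine Or.inr (Or.inr ⟨k, hk, ?_, ?_, ?_, ?_, fun j h1 h2 h3 h4 => ?_⟩) <;>
    rw [Subgroup.coe_mul, Perm.mul_apply]
  · rw [flip_two]
  · rw [flip_one]
  · rw [flip_self]
  · rw [flip_three]
  · rw [flip_of_ne hn hk h1 h2 h3 h4]

end

theorem adj_mul_rot (v : alternatingGroup (Fin n)) :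
    (alternatingGroupNetwork n hn).Adj v (v * rot hn) := by
  rw [adj_iff]
  refine Or.inr (Or.inl ⟨?_, ?_, ?_, fun j h1 h2 h3 => ?_⟩) <;>
    rw [Subgroup.coe_mul, Perm.mul_apply]
  · rw [rot_three]
  · rw [rot_one]
  · rw [rot_two]
  · rw [rot_of_ne hn h1 h2 h3]

theorem adj_mul_rot_inv (v : alternatingGroup (Fin n)) :
    (alternatingGroupNetwork n hn).Adj v (v * (rot hn)⁻¹) := by
  have := (adj_mul_rot hn (v * (rot hn)⁻¹)).symm
  rwa [inv_mul_cancel_right] at this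

variable {hn} in
theorem eq_mul_of_adj {p q : alternatingGroup (Fin n)}
    (h : (alternatingGroupNetwork n hn).Adj p q) :
    p = q * rot hn ∨ p = q * (rot hn)⁻¹ ∨ ∃ k, ∃ hk : 3 ≤ k.val, p = q * flip hn k hk := by
  rcases (adj_iff hn p q).1 h with ⟨h1, h2, h3, h4⟩ | ⟨h1, h2, h3, h4⟩ | ⟨k, hk, h1, h2, h3, h5, h4⟩
  · refine Or.inl (Subtype.ext (Equiv.ext fun j => ?_))
    rw [Subgroup.coe_mul, Perm.mul_apply]
    by_cases j1 : j = a₁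
    · rw [j1, rot_one, h1]
    by_cases j2 : j = a₂
    · rw [j2, rot_two, h2]
    by_cases j3 : j = a₃
    · rw [j3, rot_three, h3]
    rw [rot_of_ne hn j1 j2 j3, h4 j j1 j2 j3]
  · refine Or.inr (Or.inl (eq_mul_inv_of_mul_eq (Subtype.ext (Equiv.ext fun j => ?_))))
    rw [Subgroup.coe_mul, Perm.mul_apply]
    by_cases j1 : j = a₁
    · rw [j1, rot_one, h2]
    by_cases j2 : j = a₂
    · rw [j2, rot_two, h3]
    by_cases j3 : j = a₃
    · rw [j3, rot_three, h1]
    rw [rot_of_ne hn j1 j2 j3, h4 j j1 j2 j3]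
  · refine Or.inr (Or.inr ⟨k, hk, Subtype.ext (Equiv.ext fun j => ?_)⟩)
    rw [Subgroup.coe_mul, Perm.mul_apply]
    by_cases j1 : j = a₁
    · rw [j1, flip_one, h1]
    by_cases j2 : j = a₂
    · rw [j2, flip_two, h2]
    by_cases j3 : j = a₃
    · rw [j3, flip_three, h3]
    by_cases j4 : j = k
    · rw [j4, flip_self, h5]
    rw [flip_of_ne hn hk j1 j2 j3 j4, h4 j j1 j2 j3 j4]

/-- Even permutations that agree in their first three positions up to order are equal or
adjacent. -/
theorem eq_or_adj_of_agree {u v : alternatingGroup (Fin n)}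
    (h : ∀ j : Fin n, 3 ≤ j.val → u.1 j = v.1 j) :
    u = v ∨ (alternatingGroupNetwork n hn).Adj u v := by
  have hval : ∀ j : Fin n, j.val < 3 → u.1 j = v.1 a₁ ∨ u.1 j = v.1 a₂ ∨ u.1 j = v.1 a₃ := by
    intro j hj
    by_contra! hne
    have hx : 3 ≤ (v.1.symm (u.1 j)).val := by
      refine three_le_of_ne (hn := hn) ?_ ?_ ?_ <;> rw [ne_eq, Equiv.symm_apply_eq]
      exacts [hne.1, hne.2.1, hne.2.2]
    have := h _ hx
    rw [Equiv.apply_symm_apply] at this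
    rw [u.1.injective this] at hx
    omega
  have hsign : ∀ x y : Fin n, x ≠ y → u.1 ≠ v.1 * swap x y := by
    intro x y hxy he
    have h1 := Perm.mem_alternatingGroup.1 u.2
    rw [he, map_mul, Perm.mem_alternatingGroup.1 v.2, Perm.sign_swap hxy] at h1
    exact absurd h1 (by decide)
  have hinj : ∀ x y : Fin n, u.1 x = u.1 y → x = y := fun x y he => u.1.injective he
  have d12 := one_ne_two hn
  have d13 := one_ne_three hn
  have d23 := two_ne_three hn
  have hne : ∀ {j}, j ≠ a₁ → j ≠ a₂ → j ≠ a₃ → u.1 j = v.1 j := fun h1 h2 h3 =>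
    h _ (three_le_of_ne h1 h2 h3)
  rcases hval a₁ (by simp [posOne]) with h1 | h1 | h1 <;>
  rcases hval a₂ (by simp [posTwo]) with h2 | h2 | h2 <;>
  rcases hval a₃ (by simp [posThree]) with h3 | h3 | h3 <;>
  first
  | exact absurd (hinj _ _ (h1.trans h2.symm)) d12
  | exact absurd (hinj _ _ (h1.trans h3.symm)) d13
  | exact absurd (hinj _ _ (h2.trans h3.symm)) d23
  | skip
  · refine Or.inl (Subtype.ext (Equiv.ext fun j => ?_))
    by_cases j1 : j = a₁
    · rw [j1, h1]
    by_cases j2 : j = a₂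
    · rw [j2, h2]
    by_cases j3 : j = a₃
    · rw [j3, h3]
    exact hne j1 j2 j3
  · refine absurd (Equiv.ext fun j => ?_) (hsign a₂ a₃ d23)
    rw [Perm.mul_apply]
    by_cases j1 : j = a₁
    · rw [j1, h1, swap_apply_of_ne_of_ne d12 d13]
    by_cases j2 : j = a₂
    · rw [j2, h2, swap_apply_left]
    by_cases j3 : j = a₃
    · rw [j3, h3, swap_apply_right]
    rw [swap_apply_of_ne_of_ne j2 j3, hne j1 j2 j3]
  · refine absurd (Equiv.ext fun j => ?_) (hsign a₁ a₂ d12)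
    rw [Perm.mul_apply]
    by_cases j1 : j = a₁
    · rw [j1, h1, swap_apply_left]
    by_cases j2 : j = a₂
    · rw [j2, h2, swap_apply_right]
    by_cases j3 : j = a₃
    · rw [j3, h3, swap_apply_of_ne_of_ne d13.symm d23.symm]
    rw [swap_apply_of_ne_of_ne j1 j2, hne j1 j2 j3]
  · exact Or.inr ((adj_iff hn u v).2 (Or.inl ⟨h1, h2, h3, fun j => hne⟩))
  · exact Or.inr ((adj_iff hn u v).2 (Or.inr (Or.inl ⟨h1, h2, h3, fun j => hne⟩)))
  · refine absurd (Equiv.ext fun j => ?_) (hsign a₁ a₃ d13)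
    rw [Perm.mul_apply]
    by_cases j1 : j = a₁
    · rw [j1, h1, swap_apply_left]
    by_cases j2 : j = a₂
    · rw [j2, h2, swap_apply_of_ne_of_ne d12.symm d23]
    by_cases j3 : j = a₃
    · rw [j3, h3, swap_apply_right]
    rw [swap_apply_of_ne_of_ne j1 j3, hne j1 j2 j3]

/-- The even permutations that agree with `p` in all but the first `m` positions. -/
def block (p : alternatingGroup (Fin n)) (m : ℕ) : Finset (alternatingGroup (Fin n)) :=
  {v | ∀ j : Fin n, m ≤ j.val → v.1 j = p.1 j}

/-- The symbols in the first `m` positions of `p`. -/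
def symbols (p : alternatingGroup (Fin n)) (m : ℕ) : Finset (Fin n) :=
  ({j | j.val < m} : Finset (Fin n)).image p.1

theorem mem_block {p v : alternatingGroup (Fin n)} {m : ℕ} :
    v ∈ block p m ↔ ∀ j : Fin n, m ≤ j.val → v.1 j = p.1 j := by
  simp [block]

theorem card_filter_val_lt {m : ℕ} (hm : m ≤ n) : #{j : Fin n | j.val < m} = m := by
  rw [Fin.card_filter_val_lt, min_eq_right hm]

theorem card_symbols (p : alternatingGroup (Fin n)) {m : ℕ} (hm : m ≤ n) :
    #(symbols p m) = m := by
  rw [symbols, card_image_of_injective _ p.1.injective, card_filter_val_lt hm]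

theorem apply_mem_symbols {p : alternatingGroup (Fin n)} {m : ℕ} {π : Perm (Fin n)}
    (hπ : ∀ j : Fin n, m ≤ j.val → π j = p.1 j) {k : Fin n} :
    π k ∈ symbols p m ↔ k.val < m := by
  constructor
  · intro hk
    obtain ⟨l, hl, hlk⟩ := mem_image.1 hk
    by_contra! hmk
    rw [hπ k hmk] at hlk
    rw [p.1.injective hlk] at hl
    simp at hl
    omega
  · intro hk
    refine mem_image.2 ⟨p.1.symm (π k), ?_, by simp⟩
    simp only [mem_filter, mem_univ, true_and]
    by_contra! hmk
    have := hπ _ hmk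
    rw [Equiv.apply_symm_apply] at this
    rw [π.injective this] at hmk
    omega

theorem exists_perm_apply_eq {p : alternatingGroup (Fin n)} {m : ℕ} {π : Perm (Fin n)}
    (hπ : ∀ j : Fin n, m ≤ j.val → π j = p.1 j) {x y : Fin n} (hx : x.val < m)
    (hy : y ∈ symbols p m) :
    ∃ ρ : Perm (Fin n), (∀ j : Fin n, m ≤ j.val → ρ j = p.1 j) ∧ ρ x = y ∧
      ∀ z, z ≠ x → π z ≠ y → ρ z = π z := by
  have hy' : (π.symm y).val < m := by
    rw [← apply_mem_symbols hπ, Equiv.apply_symm_apply]; exact hy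
  refine ⟨π * swap x (π.symm y), fun j hj => ?_, by simp, fun z hz hzy => ?_⟩
  · rw [Perm.mul_apply, swap_apply_of_ne_of_ne, hπ j hj]
    · rintro rfl; omega
    · rintro rfl; omega
  · rw [Perm.mul_apply, swap_apply_of_ne_of_ne hz]
    rintro rfl
    simp at hzy

/-- An odd permutation is made even by swapping two positions whose contents are free. -/
theorem exists_even_of_agree {p : alternatingGroup (Fin n)} {m : ℕ} {π : Perm (Fin n)}
    (hπ : ∀ j : Fin n, m ≤ j.val → π j = p.1 j) {x y : Fin n} (hxy : x ≠ y) (hx : x.val < m)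
    (hy : y.val < m) :
    ∃ v ∈ block p m, ∀ z, z ≠ x → z ≠ y → v.1 z = π z := by
  rcases Int.units_eq_one_or (Perm.sign π) with h | h
  · exact ⟨⟨π, Perm.mem_alternatingGroup.2 h⟩, mem_block.2 hπ, fun z _ _ => rfl⟩
  · refine ⟨⟨π * swap x y, Perm.mem_alternatingGroup.2 ?_⟩, mem_block.2 fun j hj => ?_,
      fun z hzx hzy => ?_⟩
    · rw [map_mul, h, Perm.sign_swap hxy]; rfl
    · change π (swap x y j) = _
      rw [swap_apply_of_ne_of_ne, hπ j hj]
      · rintro rfl; omega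
      · rintro rfl; omega
    · change π (swap x y z) = _
      rw [swap_apply_of_ne_of_ne hzx hzy]

theorem exists_perm_two {p : alternatingGroup (Fin n)} {m : ℕ} {e : Fin n} (he : 3 ≤ e.val)
    (hem : e.val < m) {i j : Fin n} (hi : i ∈ symbols p m) (hj : j ∈ symbols p m) (hij : i ≠ j) :
    ∃ π : Perm (Fin n), (∀ j : Fin n, m ≤ j.val → π j = p.1 j) ∧ π e = i ∧ π a₃ = j := by
  obtain ⟨π, h1, h2, -⟩ := exists_perm_apply_eq (π := p.1) (fun _ _ => rfl) hem hi
  obtain ⟨ρ, h3, h4, h5⟩ := exists_perm_apply_eq (x := a₃) h1 (by simp [posThree]; omega) hj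
  exact ⟨ρ, h3, by rw [h5 e (ne_of_three_le he).2.2 (h2 ▸ hij), h2], h4⟩

theorem exists_mem_block {p : alternatingGroup (Fin n)} {m : ℕ} {e : Fin n} (he : 3 ≤ e.val)
    (hem : e.val < m) {i j : Fin n} (hi : i ∈ symbols p m) (hj : j ∈ symbols p m) (hij : i ≠ j) :
    ∃ v ∈ block p m, v.1 e = i ∧ v.1 a₃ = j := by
  obtain ⟨π, h1, h2, h3⟩ := exists_perm_two hn he hem hi hj hij
  obtain ⟨v, hv, hvπ⟩ := exists_even_of_agree (x := a₁) (y := a₂) h1 (one_ne_two hn)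
    (by simp [posOne]; omega) (by simp [posTwo]; omega)
  obtain ⟨e1, e2, e3⟩ := ne_of_three_le (hn := hn) he
  exact ⟨v, hv, by rw [hvπ e e1 e2, h2],
    by rw [hvπ _ (one_ne_three hn).symm (two_ne_three hn).symm, h3]⟩

/-- The second and fourth positions remain free to correct the parity; this is why `e` must lie
beyond the fourth. -/
theorem exists_mem_block_of_four_le {p : alternatingGroup (Fin n)} {m : ℕ} {e : Fin n}
    (he : 4 ≤ e.val) (hem : e.val < m) {i j k : Fin n} (hi : i ∈ symbols p m)
    (hj : j ∈ symbols p m) (hk : k ∈ symbols p m) (hij : i ≠ j) (hik : i ≠ k) (hjk : j ≠ k) :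
    ∃ v ∈ block p m, v.1 e = i ∧ v.1 a₃ = j ∧ v.1 a₁ = k := by
  have he' : 3 ≤ e.val := by omega
  obtain ⟨π, h1, h2, h3⟩ := exists_perm_two hn he' hem hi hj hij
  obtain ⟨e1, e2, e3⟩ := ne_of_three_le (hn := hn) he'
  obtain ⟨ρ, h4, h5, h6⟩ := exists_perm_apply_eq (x := a₁) h1 (by simp [posOne]; omega) hk
  let d : Fin n := ⟨3, by omega⟩
  obtain ⟨d1, d2, d3⟩ := ne_of_three_le (hn := hn) (k := d) le_rfl
  have hed : e ≠ d := fun h => by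
    have := congrArg Fin.val h
    simp only [d] at this
    omega
  obtain ⟨v, hv, hvρ⟩ := exists_even_of_agree (x := a₂) (y := d) h4 d2.symm
    (by simp [posTwo]; omega) (by simp [d]; omega)
  refine ⟨v, hv, ?_, ?_, ?_⟩
  · rw [hvρ e e2 hed, h6 e e1 (h2 ▸ hik), h2]
  · rw [hvρ _ (two_ne_three hn).symm d3.symm, h6 _ (one_ne_three hn).symm (h3 ▸ hjk), h3]
  · rw [hvρ _ (one_ne_two hn) d1.symm, h5]

/-! ### Blocks as layered vertex sets -/

section Block

variable {m : ℕ} (hm : 3 ≤ m) (hmn : m < n) (p : alternatingGroup (Fin n))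

include hm in
theorem mul_flip_mem_block {k : Fin n} (hk : 3 ≤ k.val) (hkm : k.val < m + 1)
    {v : alternatingGroup (Fin n)} (hv : v ∈ block p (m + 1)) :
    v * flip hn k hk ∈ block p (m + 1) := by
  rw [mem_block] at hv ⊢
  intro j hj
  obtain ⟨j1, j2, j3⟩ := ne_of_three_le (hn := hn) (k := j) (by omega)
  rw [Subgroup.coe_mul, Perm.mul_apply, flip_of_ne hn hk j1 j2 j3 (by rintro rfl; omega), hv j hj]

theorem layering : (alternatingGroupNetwork n hn).Layering (block p (m + 1)) (symbols p (m + 1))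
    (fun v => v.1 ⟨m, hmn⟩) (fun v => v.1 a₃) (fun v => v * flip hn ⟨m, hmn⟩ hm) where
  last_mem v hv := (apply_mem_symbols (mem_block.1 hv)).2 (by simp)
  third_mem v hv := (apply_mem_symbols (mem_block.1 hv)).2 (by simp [posThree]; omega)
  last_ne_third v _ he :=
    (ne_of_three_le (hn := hn) (k := ⟨m, hmn⟩) hm).2.2 (v.1.injective he)
  partner_mem v hv := mul_flip_mem_block hn hm p hm (by simp) hv
  partner_partner v := by rw [mul_assoc, flip_mul_flip, mul_one]
  last_partner v := by rw [Subgroup.coe_mul, Perm.mul_apply, flip_self]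
  third_partner v := by rw [Subgroup.coe_mul, Perm.mul_apply, flip_three]
  adj_partner v := adj_mul_flip hn hm v

/-- The first symbol can be any of the `m - 1` symbols other than `i` and `j`. -/
theorem le_card_cross (hm4 : 4 ≤ m) {i j : Fin n} (hi : i ∈ symbols p (m + 1))
    (hj : j ∈ symbols p (m + 1)) (hij : i ≠ j) :
    m - 1 ≤ #{v ∈ block p (m + 1) | v.1 ⟨m, hmn⟩ = i ∧ v.1 a₃ = j} := by
  have hsub : symbols p (m + 1) \ {i, j} ⊆
      ({v ∈ block p (m + 1) | v.1 ⟨m, hmn⟩ = i ∧ v.1 a₃ = j}).image fun v => v.1 a₁ := by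
    intro k hk
    simp only [mem_sdiff, mem_insert, mem_singleton, not_or] at hk
    obtain ⟨v, hv, h1, h2, h3⟩ := exists_mem_block_of_four_le hn (e := ⟨m, hmn⟩) hm4 (by simp)
      hi hj hk.1 hij (Ne.symm hk.2.1) (Ne.symm hk.2.2)
    exact mem_image.2 ⟨v, mem_filter.2 ⟨hv, h1, h2⟩, h3⟩
  have h1 := (card_le_card hsub).trans card_image_le
  rw [card_sdiff_of_subset (by simp [insert_subset_iff, hi, hj]), card_symbols p (by omega),
    card_pair hij] at h1
  omega

-- The neighbours are told apart by their third symbol, which can be the symbol of `v` at any of the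
-- first `m` positions except the third.
include hm in
theorem le_card_neighbours [DecidableRel (alternatingGroupNetwork n hn).Adj]
    {v : alternatingGroup (Fin n)} (hv : v ∈ block p (m + 1)) :
    m - 1 ≤ #{u ∈ block p (m + 1) |
      (alternatingGroupNetwork n hn).Adj v u ∧ u.1 ⟨m, hmn⟩ = v.1 ⟨m, hmn⟩} := by
  obtain ⟨m1, m2, m3⟩ := ne_of_three_le (hn := hn) (k := ⟨m, hmn⟩) hm
  have hrot : ∀ j : Fin n, m ≤ j.val → (rot hn).1 j = j := fun j hj => by
    obtain ⟨j1, j2, j3⟩ := ne_of_three_le (hn := hn) (k := j) (by omega)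
    exact rot_of_ne hn j1 j2 j3
  have hrot' : ∀ j : Fin n, m ≤ j.val → ((rot hn)⁻¹).1 j = j := fun j hj => by
    change (rot hn).1⁻¹ j = j
    rw [Perm.inv_eq_iff_eq, hrot j hj]
  have hsub : ((({j | j.val < m} : Finset (Fin n)).erase a₃).image v.1) ⊆
      ({u ∈ block p (m + 1) |
        (alternatingGroupNetwork n hn).Adj v u ∧ u.1 ⟨m, hmn⟩ = v.1 ⟨m, hmn⟩}).image
        fun u => u.1 a₃ := by
    intro y hy
    obtain ⟨x, hx, rfl⟩ := mem_image.1 hy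
    simp only [mem_erase, mem_filter, mem_univ, true_and] at hx
    rw [mem_block] at hv
    by_cases x1 : x = a₁
    · refine mem_image.2 ⟨v * rot hn, mem_filter.2 ⟨mem_block.2 fun j hj => ?_,
        adj_mul_rot hn v, ?_⟩, ?_⟩
      · rw [Subgroup.coe_mul, Perm.mul_apply, hrot j (by omega), hv j hj]
      · rw [Subgroup.coe_mul, Perm.mul_apply, hrot _ le_rfl]
      · rw [Subgroup.coe_mul, Perm.mul_apply, rot_three, x1]
    by_cases x2 : x = a₂
    · refine mem_image.2 ⟨v * (rot hn)⁻¹, mem_filter.2 ⟨mem_block.2 fun j hj => ?_,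
        adj_mul_rot_inv hn v, ?_⟩, ?_⟩
      · rw [Subgroup.coe_mul, Perm.mul_apply, hrot' j (by omega), hv j hj]
      · rw [Subgroup.coe_mul, Perm.mul_apply, hrot' _ le_rfl]
      · rw [Subgroup.coe_mul, Perm.mul_apply, x2]
        exact congrArg _ (Perm.inv_eq_iff_eq.2 (rot_two hn).symm)
    have hx3 := three_le_of_ne x1 x2 hx.1
    refine mem_image.2 ⟨v * flip hn x hx3, mem_filter.2
      ⟨mul_flip_mem_block hn hm p hx3 (by omega) (mem_block.2 hv), adj_mul_flip hn hx3 v, ?_⟩, ?_⟩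
    · rw [Subgroup.coe_mul, Perm.mul_apply, flip_of_ne hn hx3 m1 m2 m3]
      rintro rfl
      simp at hx
    · rw [Subgroup.coe_mul, Perm.mul_apply, flip_three]
  have h1 := (card_le_card hsub).trans card_image_le
  rwa [card_image_of_injective _ v.1.injective, card_erase_of_mem (by simp [posThree]; omega),
    card_filter_val_lt hmn.le] at h1

include hn hm in
theorem exists_layer_eq_block {i : Fin n} (hi : i ∈ symbols p (m + 1)) :
    ∃ q, {v ∈ block p (m + 1) | v.1 ⟨m, hmn⟩ = i} = block q m := by
  obtain ⟨j, hj⟩ : ((symbols p (m + 1)).erase i).Nonempty := by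
    rw [← card_pos, card_erase_of_mem hi, card_symbols p (by omega)]
    omega
  rw [mem_erase] at hj
  obtain ⟨q, hq, hqi, -⟩ := exists_mem_block hn (e := ⟨m, hmn⟩) hm (by simp) hi hj.2 hj.1.symm
  refine ⟨q, ?_⟩
  ext v
  rw [mem_block] at hq
  rw [mem_filter, mem_block, mem_block]
  constructor
  · rintro ⟨h1, h2⟩ j hj
    obtain hj | hj := hj.lt_or_eq
    · rw [h1 j hj, hq j hj]
    · obtain rfl : j = ⟨m, hmn⟩ := Fin.ext hj.symm
      rw [h2, hqi]
  · intro h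
    exact ⟨fun j hj => by rw [h j (by omega), hq j hj], by rw [h _ le_rfl, hqi]⟩

end Block

theorem fewColours_block {m : ℕ} (hm : 4 ≤ m) (hmn : m ≤ n) (p : alternatingGroup (Fin n)) :
    (alternatingGroupNetwork n hn).FewColours (block p m) m := by
  classical
  induction m, hm using Nat.le_induction generalizing p with
  | base =>
    refine (layering hn (m := 3) le_rfl hmn p).fewColours_four (card_symbols p hmn)
      (fun i hi j hj hij => exists_mem_block hn le_rfl (by simp) hi hj hij)
      fun u hu v hv huv => eq_or_adj_of_agree hn fun j hj => ?_
    rw [mem_block] at hu hv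
    obtain hj | hj := hj.lt_or_eq
    · rw [hu j hj, hv j hj]
    · obtain rfl : j = ⟨3, hmn⟩ := Fin.ext hj.symm
      exact huv
  | succ m hm ih =>
    refine (layering hn (by omega) hmn p).fewColours_succ hm (card_symbols p hmn)
      (fun i hi j hj hij => le_card_cross hn hmn p hm hi hj hij) (fun u v => three_ne_of_adj)
      (fun v hv => le_card_neighbours hn (by omega) hmn p hv) fun i hi => ?_
    obtain ⟨q, hq⟩ := exists_layer_eq_block hn (by omega) hmn p hi
    rw [hq]
    exact ih (by omega) q

end AlternatingGroupNetwork

end AlternatingGroupNetwork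

/-! ### Component cuts: the upper and lower bounds -/

section AlternatingGroupNetwork

open Finset Equiv

theorem SimpleGraph.Reachable.eq_of_isolated {V : Type*} {G : SimpleGraph V} {x y : V}
    (hx : ∀ z, ¬ G.Adj x z) (h : G.Reachable x y) : x = y := by
  obtain ⟨w⟩ := h
  cases w with
  | nil => rfl
  | cons hxz _ => exact absurd hxz (hx _)

/-- Deleting `F` leaves at least four components when it isolates three vertices and misses a
fourth one. -/
theorem SimpleGraph.isComponentCut_four {V : Type*} [Finite V] {G : SimpleGraph V} {F : Finset V}
    {x y z w : V} (hx : x ∉ F) (hy : y ∉ F) (hz : z ∉ F) (hw : w ∉ F)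
    (hxF : ∀ u, G.Adj x u → u ∈ F) (hyF : ∀ u, G.Adj y u → u ∈ F) (hzF : ∀ u, G.Adj z u → u ∈ F)
    (hxy : x ≠ y) (hxz : x ≠ z) (hxw : x ≠ w) (hyz : y ≠ z) (hyw : y ≠ w) (hzw : z ≠ w) :
    G.IsComponentCut 4 F := by
  classical
  have := Fintype.ofFinite V
  let H := G.induce (F : Set V)ᶜ
  have hiso : ∀ (a : V) (ha : a ∉ F), (∀ u, G.Adj a u → u ∈ F) → ∀ (b : V) (hb : b ∉ F), a ≠ b →
      H.connectedComponentMk ⟨a, ha⟩ ≠ H.connectedComponentMk ⟨b, hb⟩ := by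
    intro a ha haF b hb hab he
    have := (SimpleGraph.ConnectedComponent.exact he).eq_of_isolated
      (fun u hu => u.2 (haF _ hu))
    exact hab (congrArg Subtype.val this)
  refine Or.inl ⟨fun hpre => hiso x hx hxF y hy hxy
    (SimpleGraph.ConnectedComponent.sound (hpre _ _)), ?_⟩
  have hcard : #({H.connectedComponentMk ⟨x, hx⟩, H.connectedComponentMk ⟨y, hy⟩,
      H.connectedComponentMk ⟨z, hz⟩, H.connectedComponentMk ⟨w, hw⟩} :
      Finset H.ConnectedComponent) = 4 := by
    rw [card_insert_of_notMem, card_insert_of_notMem, card_insert_of_notMem, card_singleton]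
    · exact fun h => hiso z hz hzF w hw hzw (mem_singleton.1 h)
    · simp only [mem_insert, mem_singleton, not_or]
      exact ⟨hiso y hy hyF z hz hyz, hiso y hy hyF w hw hyw⟩
    · simp only [mem_insert, mem_singleton, not_or]
      exact ⟨hiso x hx hxF y hy hxy, hiso x hx hxF z hz hxz, hiso x hx hxF w hw hxw⟩
  rw [Nat.card_eq_fintype_card, ← hcard]
  exact card_le_univ _

namespace AlternatingGroupNetwork

variable {n : ℕ}

theorem three_mul_le_card (hn : 4 ≤ n) : 3 * n - 2 ≤ Nat.card (alternatingGroup (Fin n)) := by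
  have : Nontrivial (Fin n) := Fin.nontrivial_iff_two_le.2 (by omega)
  have h1 := two_mul_nat_card_alternatingGroup (α := Fin n)
  rw [Nat.card_perm, Nat.card_fin] at h1
  have h2 : 6 * n ≤ n.factorial := by
    clear h1 this
    induction n, hn using Nat.le_induction with
    | base => decide
    | succ m hm ih =>
      rw [Nat.factorial_succ]
      nlinarith
  omega

theorem exists_isComponentCut (hn : 4 ≤ n) : ∃ F : Finset (alternatingGroup (Fin n)),
    #F ≤ 3 * n - 6 ∧
      (alternatingGroupNetwork n (Nat.le_of_succ_le hn)).IsComponentCut 4 F := by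
  classical
  have hn3 : 3 ≤ n := Nat.le_of_succ_le hn
  set G := alternatingGroupNetwork n hn3 with hG
  let d : Fin n := ⟨3, hn⟩
  obtain ⟨d1, d2, d3⟩ := ne_of_three_le (hn := hn3) (k := d) le_rfl
  set s := rot hn3 with hs
  set t := flip hn3 d le_rfl with ht
  have htt : t * t = 1 := flip_mul_flip hn3 le_rfl
  have hbraid : s * t * s * t * s = t := rot_mul_flip_braid hn3 le_rfl
  -- All generators except `t`: the neighbour `x * t` of each `x ∈ T` is also `y * s` for some `y ∈
  -- T`, which saves three vertices.
  let gens : Finset (alternatingGroup (Fin n)) := {s, s⁻¹} ∪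
    (({k | k.val < 4} : Finset (Fin n))ᶜ.attach.image fun k => flip hn3 k.1 (by
      have := k.2
      simp only [mem_compl, mem_filter, mem_univ, true_and] at this
      omega))
  have hgens : #gens ≤ n - 2 := by
    have h1 : #gens ≤ 2 + (n - 4) := by
      refine (card_union_le _ _).trans (add_le_add card_le_two (card_image_le.trans ?_))
      rw [card_attach, card_compl, Fintype.card_fin, card_filter_val_lt hn]
    omega
  have hadj : ∀ v, ∀ g ∈ gens, G.Adj v (v * g) := by
    intro v g hg
    simp only [gens, mem_union, mem_insert, mem_singleton, mem_image] at hg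
    rcases hg with (rfl | rfl) | ⟨k, -, rfl⟩
    · exact adj_mul_rot hn3 v
    · exact adj_mul_rot_inv hn3 v
    · exact adj_mul_flip hn3 _ v
  let T : Finset (alternatingGroup (Fin n)) := {1, s * t, s * t * s * t}
  let F := (T ×ˢ gens).image fun p => p.1 * p.2
  have hsF : ∀ x ∈ T, ∀ g ∈ gens, x * g ∈ F := fun x hx g hg =>
    mem_image.2 ⟨(x, g), mem_product.2 ⟨hx, hg⟩, rfl⟩
  have hsg : s ∈ gens := by simp [gens]
  have htF : ∀ x ∈ T, x * t ∈ F := by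
    intro x hx
    simp only [T, mem_insert, mem_singleton] at hx
    rcases hx with rfl | rfl | rfl
    · rw [one_mul, ← hbraid]
      exact hsF _ (by simp [T]) _ hsg
    · rw [mul_assoc, htt, mul_one, ← one_mul s]
      exact hsF _ (by simp [T]) _ hsg
    · rw [mul_assoc, htt, mul_one]
      exact hsF _ (by simp [T]) _ hsg
  have hF : ∀ x ∈ T, ∀ u, G.Adj x u → u ∈ F := by
    intro x hx u hu
    rcases eq_mul_of_adj hu.symm with rfl | rfl | ⟨k, hk, rfl⟩
    · exact hsF x hx _ hsg
    · exact hsF x hx _ (by simp [gens, hs])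
    · by_cases hkd : k = d
      · subst hkd
        exact htF x hx
      · refine hsF x hx _ (mem_union_right _ (mem_image.2 ⟨⟨k, ?_⟩, mem_attach _ _, rfl⟩))
        simp only [mem_compl, mem_filter, mem_univ, true_and]
        intro hk4
        exact hkd (Fin.ext (by simp only [d]; omega))
  have hT : ∀ x ∈ T, x.1 (posTwo hn3) = posTwo hn3 := by
    intro x hx
    have hst : s.1 (t.1 (posTwo hn3)) = posTwo hn3 := by rw [hs, ht, flip_two, rot_one]
    simp only [T, mem_insert, mem_singleton] at hx
    rcases hx with rfl | rfl | rfl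
    · rfl
    · exact hst
    · simp only [Subgroup.coe_mul, Perm.mul_apply, hst]
  have hTF : ∀ x ∈ T, x ∉ F := by
    intro x hx hxF
    obtain ⟨⟨y, g⟩, hyg, rfl⟩ := mem_image.1 hxF
    obtain ⟨hy, hg⟩ := mem_product.1 hyg
    exact two_ne_of_adj (hadj y g hg) ((hT y hy).trans (hT _ hx).symm)
  have h1 : (s * t).1 (posOne hn3) = posThree hn3 := by
    rw [Subgroup.coe_mul, Perm.mul_apply, hs, ht, flip_one, rot_two]
  have h2 : (s * t * s * t).1 (posOne hn3) = d := by
    rw [mul_assoc, Subgroup.coe_mul, Perm.mul_apply, h1, Subgroup.coe_mul, Perm.mul_apply, hs, ht,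
      flip_three, rot_of_ne hn3 d1 d2 d3]
  have hne1 : (1 : alternatingGroup (Fin n)) ≠ s * t := fun h => by
    rw [← h] at h1
    exact one_ne_three hn3 h1
  have hne2 : (1 : alternatingGroup (Fin n)) ≠ s * t * s * t := fun h => by
    rw [← h] at h2
    exact d1 h2.symm
  have hne3 : s * t ≠ s * t * s * t := fun h => by
    rw [← h, h1] at h2
    exact d3 h2.symm
  have hFcard : #F ≤ 3 * n - 6 := by
    have h3 : #F ≤ 3 * (n - 2) := by
      refine card_image_le.trans ?_
      rw [card_product]
      exact Nat.mul_le_mul card_le_three hgens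
    omega
  obtain ⟨w, hw⟩ : ∃ w, w ∉ F ∪ T := by
    by_contra! hall
    have h3 := card_union_le F T
    rw [eq_univ_of_forall hall, card_univ, ← Nat.card_eq_fintype_card] at h3
    have h4 := three_mul_le_card hn
    have h5 : #T ≤ 3 := card_le_three
    omega
  rw [mem_union, not_or] at hw
  have hT1 : (1 : alternatingGroup (Fin n)) ∈ T := by simp [T]
  have hT2 : s * t ∈ T := by simp [T]
  have hT3 : s * t * s * t ∈ T := by simp [T]
  exact ⟨F, hFcard, SimpleGraph.isComponentCut_four (hTF _ hT1) (hTF _ hT2) (hTF _ hT3) hw.1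
    (hF _ hT1) (hF _ hT2) (hF _ hT3) hne1 hne2 (fun h => hw.2 (h ▸ hT1)) hne3
    (fun h => hw.2 (h ▸ hT2)) (fun h => hw.2 (h ▸ hT3))⟩

theorem le_card_of_isComponentCut (hn : 4 ≤ n) {F : Finset (alternatingGroup (Fin n))}
    (hF : (alternatingGroupNetwork n (Nat.le_of_succ_le hn)).IsComponentCut 4 F) :
    3 * n - 6 ≤ #F := by
  classical
  by_contra! hlt
  rcases hF with ⟨-, hcomp⟩ | hcard
  · let H := (alternatingGroupNetwork n (Nat.le_of_succ_le hn)).induce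
      (F : Set (alternatingGroup (Fin n)))ᶜ
    change 4 ≤ Nat.card H.ConnectedComponent at hcomp
    let f : alternatingGroup (Fin n) → Option H.ConnectedComponent := fun v =>
      if hv : v ∈ F then none else
        some (SimpleGraph.connectedComponentMk H ⟨v, hv⟩)
    have hblock : block (1 : alternatingGroup (Fin n)) n = univ := by
      ext v
      simp only [mem_block, mem_univ, iff_true]
      intro j hj
      exact absurd j.2 (by omega)
    have h1 := (fewColours_block (Nat.le_of_succ_le hn) hn le_rfl 1 F f (by
      intro u hu v hv huv
      have hu' := (mem_sdiff.1 hu).2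
      have hv' := (mem_sdiff.1 hv).2
      simp only [f, hu', hv', dif_neg, not_false_eq_true, Option.some.injEq]
      have hH : H.Adj ⟨u, hu'⟩ ⟨v, hv'⟩ := huv
      exact SimpleGraph.ConnectedComponent.sound hH.reachable)).2.2 (by
        rw [hblock, univ_inter]; omega)
    have h2 : (univ : Finset H.ConnectedComponent).image some ⊆
        (block (1 : alternatingGroup (Fin n)) n \ F).image f := by
      intro x hx
      obtain ⟨c, -, rfl⟩ := mem_image.1 hx
      induction c using SimpleGraph.ConnectedComponent.ind with
      | _ v =>
        have hv : v.1 ∉ F := v.2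
        exact mem_image.2 ⟨v.1, by simp [hblock, hv], by simp [f, hv]⟩
    have h3 := card_le_card h2
    rw [card_image_of_injective _ (Option.some_injective _), card_univ,
      ← Nat.card_eq_fintype_card] at h3
    omega
  · have h1 := three_mul_le_card hn
    have h2 : Nat.card ((F : Set (alternatingGroup (Fin n)))ᶜ : Set _) = #Fᶜ := by
      rw [← coe_compl, Nat.card_coe_set_eq, Set.ncard_coe_finset]
    rw [h2, card_compl, ← Nat.card_eq_fintype_card] at hcard
    omega

end AlternatingGroupNetwork

end AlternatingGroupNetwork

theorem theorem1 (n : ℕ) (hn : 4 ≤ n) :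
    (alternatingGroupNetwork n (Nat.le_of_succ_le hn)).componentConnectivity 4 = 3 * n - 6 := by
  obtain ⟨F, hF, hcut⟩ := AlternatingGroupNetwork.exists_isComponentCut hn
  have hmem : F.card ∈ {k : ℕ | ∃ F' : Finset (alternatingGroup (Fin n)), F'.card = k ∧
      (alternatingGroupNetwork n (Nat.le_of_succ_le hn)).IsComponentCut 4 F'} := ⟨F, rfl, hcut⟩
  refine le_antisymm ((Nat.sInf_le hmem).trans hF) (le_csInf ⟨_, hmem⟩ ?_)
  rintro k ⟨F', rfl, hF'⟩
  exact AlternatingGroupNetwork.le_card_of_isComponentCut hn hF'
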